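/- Let $\mathbb{S}^2\subset\mathbb{R}^3$ be the unit sphere with geodesic distance $d(x,y)=\arccos(x\cdot y)$, tangent planes $T_x\mathbb{S}^2=x^\perp$ and exponential map $\exp_x(v)=\cos(\|v\|)\,x+\frac{\sin\|v\|}{\|v\|}\,v$ (with $\exp_x(0)=x$). For a $C^2$ function $\phi$ near $x$ let $\nabla\phi(x)\in T_x\mathbb{S}^2$ be its gradient and $D^2\phi(x)$ its Hessian, the symmetric endomorphism of $T_x\mathbb{S}^2$ with $\langle D^2\phi(x)\xi,\xi\rangle=\frac{d^2}{dt^2}\big|_{t=0}\phi(\exp_x(t\xi))$. Let $\phi_0,\phi_h\in C^2(\mathbb{S}^2;\mathbb{R})$ be fixed functions, let $\gamma\ge 1$ be a constant, and for $h>0$, $x\in\mathbb{S}^2$, $s\in[0,1]$ and $t\in[0,h]$ put $$F_x(s,t)=\exp_x\bigl((1-s)t\nabla\phi_0(x)+hst\nabla\phi_h(x)\bigr),$$ $$A_{x,t}(s)=\tfrac12 D_x^2d^2(x,y)\big|_{y=F_x(s,h)}+(1-s)t\,D^2\phi_0(x)+hst\,D^2\phi_h(x),$$ where $y$ is held fixed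 while the Hessian in $x$ is taken. (a) Let $h>0$ be such that $h\|\nabla\phi_0(x)\|+\gamma h^2\|\nabla\phi_h(x)\|<\pi/2$ for all $x\in\mathbb{S}^2$. Then for every $x\in\mathbb{S}^2$ and $t\in[0,h]$ such that $A_{x,t}(s)$ is positive definite for all $s\in[0,1]$, the function $s\mapsto\log\det A_{x,t}(s)$ is concave on $[0,1]$. (b) There is $h_0>0$, depending on $\phi_0,\phi_h,\gamma$, such that for every $0<h<h_0$ the gradient bound in (a) holds and $A_{x,t}(s)$ is positive definite for all $x\in\mathbb{S}^2$, $t\in[0,h]$ and $s\in[0,1]$. Consequently, for all sufficiently small $h>0$, the function $s\mapsto\log\det A_{x,t}(s)$ is concave on $[0,1]$ for all $x\in\mathbb{S}^2$ and $t\in[0,h]$, in particular for $t=h$. -/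

import Mathlib

open scoped Manifold ContDiff RealInnerProductSpace

noncomputable section

/-- The unit sphere `𝕊²` in Euclidean space `ℝ³`. -/
abbrev S2 : Type := Metric.sphere (0 : EuclideanSpace ℝ (Fin 3)) 1

namespace S2

/-- The tangent space `T_x 𝕊²`, the plane through the origin orthogonal to `x`, with the inner
product of `ℝ³`. -/
abbrev Tan (x : S2) : Type :=
  ((Submodule.span ℝ {(x : EuclideanSpace ℝ (Fin 3))})ᗮ :
    Submodule ℝ (EuclideanSpace ℝ (Fin 3)))

/-- The geodesic distance `d(x, y) = arccos (x ⬝ y)`. -/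
def gdist (x y : S2) : ℝ :=
  Real.arccos ⟪(x : EuclideanSpace ℝ (Fin 3)), (y : EuclideanSpace ℝ (Fin 3))⟫

theorem norm_cos_add_sinc (x : S2) (v : Tan x) :
    ‖Real.cos ‖v‖ • (x : EuclideanSpace ℝ (Fin 3)) +
      Real.sinc ‖v‖ • (v : EuclideanSpace ℝ (Fin 3))‖ = 1 := by
  have hx : ‖(x : EuclideanSpace ℝ (Fin 3))‖ = 1 := by simp
  have hxv : ⟪(x : EuclideanSpace ℝ (Fin 3)), (v : EuclideanSpace ℝ (Fin 3))⟫ = 0 :=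
    Submodule.mem_orthogonal_singleton_iff_inner_right.mp v.2
  have hs : Real.sinc ‖v‖ * ‖v‖ = Real.sin ‖v‖ := by
    by_cases h : ‖v‖ = 0
    · simp [h]
    · rw [Real.sinc_of_ne_zero h]
      field_simp
  have hsq : ‖Real.cos ‖v‖ • (x : EuclideanSpace ℝ (Fin 3)) +
      Real.sinc ‖v‖ • (v : EuclideanSpace ℝ (Fin 3))‖ ^ 2 = 1 := by
    rw [norm_add_sq_real, inner_smul_left, inner_smul_right, hxv, norm_smul, norm_smul, hx,
      Real.norm_eq_abs, Real.norm_eq_abs, mul_pow, mul_pow, sq_abs, sq_abs, ← Submodule.coe_norm,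
      ← mul_pow (Real.sinc _), hs]
    simp
  exact (pow_eq_one_iff_of_nonneg (norm_nonneg _) two_ne_zero).mp hsq

/-- The Riemannian exponential map `exp_x v = cos ‖v‖ x + (sin ‖v‖ / ‖v‖) v`. -/
def exp (x : S2) (v : Tan x) : S2 :=
  ⟨Real.cos ‖v‖ • (x : EuclideanSpace ℝ (Fin 3)) +
      Real.sinc ‖v‖ • (v : EuclideanSpace ℝ (Fin 3)),
    mem_sphere_zero_iff_norm.mpr (norm_cos_add_sinc x v)⟩

/-- The gradient `∇φ(x) ∈ T_x 𝕊²`, computed in normal coordinates at `x`. -/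
def grad (φ : S2 → ℝ) (x : S2) : Tan x :=
  gradient (fun v : Tan x => φ (exp x v)) 0

/-- The Hessian `D²φ(x)` as an endomorphism of `T_x 𝕊²`: the Hessian at `0` of `φ` in normal
coordinates at `x`, so that `⟪D²φ(x) ξ, ξ⟫` is the second derivative at `t = 0` of
`t ↦ φ (exp_x (t ξ))`. -/
def hess (φ : S2 → ℝ) (x : S2) : Tan x →L[ℝ] Tan x :=
  fderiv ℝ (gradient (fun v : Tan x => φ (exp x v))) 0

/-- `F_x(s, t) = exp_x ((1 - s) t ∇φ₀(x) + h s t ∇φₕ(x))`. -/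
def interp (φ₀ φₕ : S2 → ℝ) (h : ℝ) (x : S2) (s t : ℝ) : S2 :=
  exp x (((1 - s) * t) • grad φ₀ x + (h * s * t) • grad φₕ x)

/-- The endomorphism
`½ D_x² d²(x, y) |_{y = F_x(s, h)} + (1 - s) t D²φ₀(x) + h s t D²φₕ(x)` of `T_x 𝕊²`;
`y` is held fixed while the Hessian in `x` is taken. -/
def interpHess (φ₀ φₕ : S2 → ℝ) (h : ℝ) (x : S2) (t s : ℝ) : Tan x →L[ℝ] Tan x :=
  (1 / 2 : ℝ) • hess (fun z => gdist z (interp φ₀ φₕ h x s h) ^ 2) x +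
    ((1 - s) * t) • hess φ₀ x + (h * s * t) • hess φₕ x

/-- Positive definite endomorphism of a tangent space. -/
def IsPosDef {x : S2} (A : Tan x →L[ℝ] Tan x) : Prop :=
  (∀ v w : Tan x, ⟪A v, w⟫ = ⟪v, A w⟫) ∧ ∀ v : Tan x, v ≠ 0 → 0 < ⟪A v, v⟫

end S2

end

/-!
Let `p(s) = (1 - s) h ∇φ₀(x) + h² s ∇φₕ(x)`, so that `y = exp_x p(s)` in the distance term, and let
`r = ‖p(s)‖`. For a unit vector `ξ`, differentiating `arccos²` along the great circle through `x`
in the direction `ξ` gives the quadratic form of the Hessian of `d(·, y)² / 2` at `x`, namely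
`1 - f(r) (r² - ⟪ξ, p⟫²)` with `f(r) = (1 - r cot r) / r²` (`S2.half_inner_hess_gdist_sq`).

The main point is that this is concave in `p` for `‖p‖ < π` (`S2.concaveOn_distHess`). By the
Mittag-Leffler expansion of the cotangent, `f(r) = ∑ 2 / (n²π² - r²)`, and
`r² - ⟪ξ, p⟫² = ‖p - ⟪ξ, p⟫ ξ‖²`, so the subtracted term is a sum of functions
`‖L p‖² / (c² - ‖p‖²)` with `L` linear, each of which is convex because `w² / d` is jointly convex
and decreasing in `d`. As `p` is affine in `s`, and the remaining terms of the endomorphism are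
affine in `s`, every diagonal entry `⟪A(s) ξ, ξ⟫` is concave in `s`.

By Hadamard's inequality `log det A(s)` is the minimum over orthonormal bases of
`∑ log ⟪A(s) eᵢ, eᵢ⟫`, attained at an eigenbasis; a minimum of concave functions is concave
(`S2.concaveOn_log_det`).

For small `h`, compactness of the sphere bounds the gradients and Hessians of `φ₀` and `φₕ`
(`S2.exists_bound_grad_hess`), so `‖p‖ ≤ 1`, where the distance term is at least `1 / 2`
(`S2.half_le_distHess`), and the other two terms are smaller than `1 / 2`.
-/

namespace S2

/-! ### Smoothness of the exponential map -/

/-- The entire function `w ↦ ∑ (-1)ⁿ wⁿ / (2n)!`, that is `cos √w` for `0 ≤ w`. -/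
noncomputable def cosSqrt : ℝ → ℝ :=
  FormalMultilinearSeries.ofScalarsSum (E := ℝ) fun n => (-1 : ℝ) ^ n / (2 * n).factorial

theorem contDiff_cosSqrt {n : ℕ∞ω} : ContDiff ℝ n cosSqrt := by
  -- The ratio of consecutive coefficients is `1 / ((2n + 2)(2n + 1))`, so the radius is infinite.
  have hr : (FormalMultilinearSeries.ofScalars ℝ
      fun n => (-1 : ℝ) ^ n / (2 * n).factorial).radius = ⊤ := by
    refine FormalMultilinearSeries.ofScalars_radius_eq_top_of_tendsto _ _
      (Filter.Eventually.of_forall fun n => by positivity) ?_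
    refine squeeze_zero (fun n => by positivity) (fun n => ?_)
      (tendsto_one_div_add_atTop_nhds_zero_nat (𝕜 := ℝ))
    have h1 : (0 : ℝ) < (2 * n).factorial := by positivity
    have h2 : (((2 * n.succ).factorial : ℕ) : ℝ)
        = (2 * n + 2) * (2 * n + 1) * (2 * n).factorial := by
      rw [show 2 * n.succ = 2 * n + 1 + 1 by omega, Nat.factorial_succ, Nat.factorial_succ]
      push_cast
      ring
    simp only [norm_div, norm_pow, norm_neg, norm_one, one_pow, Real.norm_natCast]
    rw [h2, div_div_div_eq, one_mul, mul_one,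
      div_le_div_iff₀ (by positivity) (by positivity)]
    have : (0 : ℝ) ≤ n := n.cast_nonneg
    nlinarith [mul_nonneg this h1.le, mul_nonneg (mul_nonneg this this) h1.le]
  have h := (FormalMultilinearSeries.ofScalars ℝ
    fun n => (-1 : ℝ) ^ n / (2 * n).factorial).hasFPowerSeriesOnBall (by simp [hr])
  rw [hr] at h
  refine AnalyticOnNhd.contDiff (𝕜 := ℝ) fun w _ => ?_
  exact h.analyticAt_of_mem (by simp)

theorem cosSqrt_sq (r : ℝ) : cosSqrt (r ^ 2) = Real.cos r := by
  rw [cosSqrt, FormalMultilinearSeries.ofScalars_sum_eq, Real.cos_eq_tsum]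
  refine tsum_congr fun n => ?_
  rw [smul_eq_mul, pow_mul]
  ring

/-- Differentiate `cosSqrt (r²) = cos r` for `r ≠ 0`, and extend to `r = 0` by continuity. -/
theorem sinc_eq_deriv_cosSqrt (r : ℝ) : Real.sinc r = -2 * deriv cosSqrt (r ^ 2) := by
  have hd : Continuous (deriv cosSqrt) := contDiff_cosSqrt (n := 1).continuous_deriv le_rfl
  have key : Set.EqOn Real.sinc (fun r => -2 * deriv cosSqrt (r ^ 2)) {0}ᶜ := by
    intro r hr
    have h1 : HasDerivAt (fun r => cosSqrt (r ^ 2)) (deriv cosSqrt (r ^ 2) * (2 * r)) r := by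
      have h := (contDiff_cosSqrt (n := 1).differentiable one_ne_zero (r ^ 2)).hasDerivAt
      have h' : HasDerivAt (fun r : ℝ => r ^ 2) (2 * r) r := by simpa using hasDerivAt_pow 2 r
      exact HasDerivAt.comp r h h'
    simp only [cosSqrt_sq] at h1
    have h2 := h1.unique (Real.hasDerivAt_cos r)
    have hr : r ≠ 0 := hr
    simp only [Real.sinc_of_ne_zero hr]
    field_simp
    linarith
  exact congrFun (Continuous.ext_on (dense_compl_singleton (0 : ℝ)) Real.continuous_sinc
    (by fun_prop) key) r

theorem contDiff_cos_norm {V : Type*} [NormedAddCommGroup V] [InnerProductSpace ℝ V] {n : ℕ∞ω} :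
    ContDiff ℝ n fun v : V => Real.cos ‖v‖ := by
  simp_rw [← cosSqrt_sq]
  exact contDiff_cosSqrt.comp (contDiff_norm_sq ℝ)

theorem contDiff_sinc_norm {V : Type*} [NormedAddCommGroup V] [InnerProductSpace ℝ V] {n : ℕ∞} :
    ContDiff ℝ n fun v : V => Real.sinc ‖v‖ := by
  simp_rw [sinc_eq_deriv_cosSqrt]
  have : ContDiff ℝ n (deriv cosSqrt) := by
    have h : ContDiff ℝ (n + 1) cosSqrt := contDiff_cosSqrt
    exact (contDiff_succ_iff_deriv.mp h).2.2
  exact contDiff_const.mul (this.comp (contDiff_norm_sq ℝ))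

theorem contDiff_exp (x : S2) {n : ℕ∞} :
    ContDiff ℝ n fun v : Tan x => (exp x v : EuclideanSpace ℝ (Fin 3)) :=
  (contDiff_cos_norm.smul contDiff_const).add
    (contDiff_sinc_norm.smul
      (Submodule.subtypeL (Submodule.span ℝ {(x : EuclideanSpace ℝ (Fin 3))})ᗮ).contDiff)

theorem exp_zero (x : S2) : exp x 0 = x := by
  ext1
  simp [exp]

theorem exp_smul (x : S2) {ξ : Tan x} (hξ : ‖ξ‖ = 1) (t : ℝ) :
    (exp x (t • ξ) : EuclideanSpace ℝ (Fin 3)) =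
      Real.cos t • (x : EuclideanSpace ℝ (Fin 3)) +
        Real.sin t • (ξ : EuclideanSpace ℝ (Fin 3)) := by
  have hs : Real.sinc |t| * t = Real.sin t := by
    have : Real.sinc |t| = Real.sinc t := by
      rcases abs_choice t with h | h <;> simp [h]
    rw [this]
    rcases eq_or_ne t 0 with rfl | h
    · simp
    · rw [Real.sinc_of_ne_zero h, div_mul_cancel₀ _ h]
  simp [exp, norm_smul, hξ, smul_smul, hs]

theorem inner_coe_tan (x : S2) (v : Tan x) :
    ⟪(x : EuclideanSpace ℝ (Fin 3)), (v : EuclideanSpace ℝ (Fin 3))⟫ = 0 :=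
  Submodule.mem_orthogonal_singleton_iff_inner_right.mp v.2

/-! ### The Hessian along geodesics -/

theorem inner_fderiv_gradient {V : Type*} [NormedAddCommGroup V] [InnerProductSpace ℝ V]
    [CompleteSpace V] (ψ : V → ℝ) (v ξ η : V) :
    ⟪fderiv ℝ (gradient ψ) v ξ, η⟫ = fderiv ℝ (fderiv ℝ ψ) v ξ η := by
  let L : V ≃L[ℝ] StrongDual ℝ V := (InnerProductSpace.toDual ℝ V).toContinuousLinearEquiv
  have hg : gradient ψ = L.symm ∘ fderiv ℝ ψ := rfl
  rw [hg, L.symm.comp_fderiv]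
  exact InnerProductSpace.toDual_symm_apply

theorem inner_hess_comm {φ : S2 → ℝ} {x : S2}
    (hφ : ContDiffAt ℝ 2 (fun v : Tan x => φ (exp x v)) 0) (ξ η : Tan x) :
    ⟪hess φ x ξ, η⟫ = ⟪ξ, hess φ x η⟫ := by
  rw [real_inner_comm _ ξ, hess, inner_fderiv_gradient, inner_fderiv_gradient]
  exact hφ.isSymmSndFDerivAt (by simp) ξ η

/-- The second derivative of a function is read off from its restrictions to lines. -/
theorem fderiv_fderiv_apply_self {V : Type*} [NormedAddCommGroup V] [NormedSpace ℝ V]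
    {ψ : V → ℝ} (hψ : ContDiffAt ℝ 2 ψ 0) {ξ : V} {g' : ℝ → ℝ} {a : ℝ}
    (h1 : ∀ᶠ t in nhds (0 : ℝ), HasDerivAt (fun t : ℝ => ψ (t • ξ)) (g' t) t)
    (h2 : HasDerivAt g' a 0) : fderiv ℝ (fderiv ℝ ψ) 0 ξ ξ = a := by
  have hline (t : ℝ) : HasDerivAt (fun t : ℝ => t • ξ) ξ t := by
    simpa using (hasDerivAt_id t).smul_const ξ
  have hlim : Filter.Tendsto (fun t : ℝ => t • ξ) (nhds 0) (nhds 0) := by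
    simpa using (hline 0).continuousAt.tendsto
  have hd : ∀ᶠ v in nhds (0 : V), DifferentiableAt ℝ ψ v :=
    (hψ.eventually (by simp)).mono fun v hv => hv.differentiableAt two_ne_zero
  have heq : (fun t : ℝ => fderiv ℝ ψ (t • ξ) ξ) =ᶠ[nhds 0] g' := by
    filter_upwards [h1, hlim.eventually hd] with t ht hdt
    have h := hdt.hasFDerivAt.comp_hasDerivAt t (hline t)
    exact h.unique ht
  have hdd : HasFDerivAt (fderiv ℝ ψ) (fderiv ℝ (fderiv ℝ ψ) 0) ((0 : ℝ) • ξ) := by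
    rw [zero_smul]
    exact ((hψ.fderiv_right (m := 1) (by norm_num)).differentiableAt one_ne_zero).hasFDerivAt
  have h3 : HasDerivAt (fun t : ℝ => fderiv ℝ ψ (t • ξ)) (fderiv ℝ (fderiv ℝ ψ) 0 ξ) 0 :=
    hdd.comp_hasDerivAt (0 : ℝ) (hline 0)
  have h4 : HasDerivAt (fun t : ℝ => fderiv ℝ ψ (t • ξ) ξ) (fderiv ℝ (fderiv ℝ ψ) 0 ξ ξ) 0 := by
    simpa using h3.clm_apply (hasDerivAt_const (0 : ℝ) ξ)
  exact h4.unique (h2.congr_of_eventuallyEq heq)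

theorem inner_hess_self {φ : S2 → ℝ} {x : S2}
    (hφ : ContDiffAt ℝ 2 (fun v : Tan x => φ (exp x v)) 0) {ξ : Tan x} {g' : ℝ → ℝ} {a : ℝ}
    (h1 : ∀ᶠ t in nhds (0 : ℝ), HasDerivAt (fun t : ℝ => φ (exp x (t • ξ))) (g' t) t)
    (h2 : HasDerivAt g' a 0) : ⟪hess φ x ξ, ξ⟫ = a := by
  rw [hess, inner_fderiv_gradient]
  exact fderiv_fderiv_apply_self hφ h1 h2

/-! ### Concavity of the distance Hessian in the velocity -/

/-- Mittag-Leffler expansion of `(1 - r cot r) / r²`; every summand has a positive concave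
denominator as a function of a vector of norm `r`. -/
theorem hasSum_one_sub_mul_cot {r : ℝ} (h0 : 0 < r) (hπ : r < Real.pi) :
    HasSum (fun n : ℕ => 2 / (((n + 1) * Real.pi) ^ 2 - r ^ 2))
      ((1 - r * Real.cot r) / r ^ 2) := by
  have hpi := Real.pi_pos
  have hx0 : 0 < r / Real.pi := by positivity
  have hx1 : r / Real.pi < 1 := (div_lt_one hpi).mpr hπ
  have hmem : ((r / Real.pi : ℝ) : ℂ) ∈ Complex.integerComplement := by
    rintro ⟨m, hm⟩
    have hm : (m : ℝ) = r / Real.pi := by exact_mod_cast hm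
    rw [← hm] at hx0 hx1
    have h1 : 0 < m := by exact_mod_cast hx0
    have h2 : m < 1 := by exact_mod_cast hx1
    omega
  have hs := (summable_cotTerm hmem).hasSum
  rw [show (∑' n, cotTerm ((r / Real.pi : ℝ) : ℂ) n) = _ from (cot_series_rep' hmem).symm] at hs
  have hs' : HasSum (fun n : ℕ => 1 / (r / Real.pi - (n + 1)) + 1 / (r / Real.pi + (n + 1)))
      (Real.pi * Real.cot r - Real.pi / r) := by
    rw [← Complex.hasSum_ofReal]
    convert hs using 1
    · ext n
      simp [cotTerm]
    · push_cast
      rw [mul_div_cancel₀ _ (by exact_mod_cast hpi.ne' : (Real.pi : ℂ) ≠ 0), one_div_div]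
  have hterm (n : ℕ) : 2 / (((n + 1) * Real.pi) ^ 2 - r ^ 2) = -(1 / (Real.pi * r)) *
      (1 / (r / Real.pi - (n + 1)) + 1 / (r / Real.pi + (n + 1))) := by
    have hn : (0 : ℝ) ≤ n := n.cast_nonneg
    have h1 : r - (n + 1) * Real.pi < 0 := by nlinarith [mul_nonneg hn hpi.le]
    have h2 : 0 < r + (n + 1) * Real.pi := by positivity
    have h3 : r / Real.pi - (n + 1) = (r - (n + 1) * Real.pi) / Real.pi := by field_simp
    have h4 : r / Real.pi + (n + 1) = (r + (n + 1) * Real.pi) / Real.pi := by field_simp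
    rw [h3, h4, show ((n + 1) * Real.pi) ^ 2 - r ^ 2
      = -((r - (n + 1) * Real.pi) * (r + (n + 1) * Real.pi)) by ring]
    have h1' := h1.ne
    generalize hu : r - (n + 1) * Real.pi = u at *
    generalize hv : r + (n + 1) * Real.pi = v at *
    have hr : r * 2 = u + v := by linarith
    field_simp
    linarith
  have hsum : (1 - r * Real.cot r) / r ^ 2
      = -(1 / (Real.pi * r)) * (Real.pi * Real.cot r - Real.pi / r) := by
    field_simp
    ring
  simp only [hterm, hsum]
  exact hs'.mul_left _

/-- `‖L p‖² / (c² - ‖p‖²)` is convex: `(w, d) ↦ w² / d` is convex and decreasing in `d`, and the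
denominator is concave. -/
theorem convexOn_norm_sq_div {V W : Type*} [NormedAddCommGroup V] [InnerProductSpace ℝ V]
    [NormedAddCommGroup W] [NormedSpace ℝ W] (L : V →ₗ[ℝ] W) (c : ℝ) :
    ConvexOn ℝ (Metric.ball (0 : V) c) fun p => ‖L p‖ ^ 2 / (c ^ 2 - ‖p‖ ^ 2) := by
  refine ⟨convex_ball _ _, fun p hp q hq a b ha hb hab => ?_⟩
  rw [mem_ball_zero_iff] at hp hq
  have hP : 0 < c ^ 2 - ‖p‖ ^ 2 := by nlinarith [norm_nonneg p]
  have hQ : 0 < c ^ 2 - ‖q‖ ^ 2 := by nlinarith [norm_nonneg q]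
  have hn : ‖L (a • p + b • q)‖ ≤ a * ‖L p‖ + b * ‖L q‖ := by
    rw [map_add, map_smul, map_smul]
    refine (norm_add_le _ _).trans_eq ?_
    rw [norm_smul, norm_smul, Real.norm_of_nonneg ha, Real.norm_of_nonneg hb]
  have hd : ‖a • p + b • q‖ ≤ a * ‖p‖ + b * ‖q‖ := by
    refine (norm_add_le _ _).trans_eq ?_
    rw [norm_smul, norm_smul, Real.norm_of_nonneg ha, Real.norm_of_nonneg hb]
  have hd2 : a * (c ^ 2 - ‖p‖ ^ 2) + b * (c ^ 2 - ‖q‖ ^ 2) ≤ c ^ 2 - ‖a • p + b • q‖ ^ 2 := by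
    have := pow_le_pow_left₀ (norm_nonneg _) hd 2
    obtain rfl : b = 1 - a := by linarith
    nlinarith [mul_nonneg (mul_nonneg ha hb) (sq_nonneg (‖p‖ - ‖q‖))]
  have hD : 0 < a * (c ^ 2 - ‖p‖ ^ 2) + b * (c ^ 2 - ‖q‖ ^ 2) := by
    rcases ha.eq_or_lt with rfl | ha
    · obtain rfl : b = 1 := by linarith
      simpa using hQ
    · have := mul_pos ha hP
      have := mul_nonneg hb hQ.le
      linarith
  have h2 := pow_le_pow_left₀ (norm_nonneg _) hn 2
  refine (div_le_div₀ (sq_nonneg _) h2 hD hd2).trans ?_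
  beta_reduce
  generalize c ^ 2 - ‖p‖ ^ 2 = P at *
  generalize c ^ 2 - ‖q‖ ^ 2 = Q at *
  change _ ≤ a • (‖L p‖ ^ 2 / P) + b • (‖L q‖ ^ 2 / Q)
  rw [div_le_iff₀ hD, smul_eq_mul, smul_eq_mul, ← sub_nonneg]
  have : (a * (‖L p‖ ^ 2 / P) + b * (‖L q‖ ^ 2 / Q)) * (a * P + b * Q)
      - (a * ‖L p‖ + b * ‖L q‖) ^ 2
      = a * b * (‖L p‖ * Q - ‖L q‖ * P) ^ 2 / (P * Q) := by
    field_simp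
    ring
  rw [this]
  positivity

/-- The quadratic form `1 - f(r) (r² - ⟪ξ, p⟫²)`, where `r = ‖p‖` and `f(r) = (1 - r cot r) / r²`:
for a unit vector `ξ`, the second derivative in the direction `ξ` of half the squared distance
to `exp_x p`. The junk value of `f` at `p = 0` is harmless, being multiplied by zero. -/
noncomputable def distHess {V : Type*} [NormedAddCommGroup V] [InnerProductSpace ℝ V]
    (ξ p : V) : ℝ :=
  1 - (1 - ‖p‖ * Real.cot ‖p‖) / ‖p‖ ^ 2 * (‖p‖ ^ 2 - ⟪ξ, p⟫ ^ 2)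

/-- Concavity holds on the whole ball of radius `π`, up to the cut locus. -/
theorem concaveOn_distHess {V : Type*} [NormedAddCommGroup V] [InnerProductSpace ℝ V] {ξ : V}
    (hξ : ‖ξ‖ = 1) : ConcaveOn ℝ (Metric.ball (0 : V) Real.pi) (distHess ξ) := by
  -- `L` is the orthogonal projection onto the complement of `ξ`.
  let L : V →ₗ[ℝ] V := LinearMap.id - ((innerSL ℝ ξ).toLinearMap.smulRight ξ)
  have hL (p : V) : ‖L p‖ ^ 2 = ‖p‖ ^ 2 - ⟪ξ, p⟫ ^ 2 := by
    simp only [L, LinearMap.sub_apply, LinearMap.id_apply, LinearMap.smulRight_apply,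
      ContinuousLinearMap.coe_coe, innerSL_apply_apply, norm_sub_sq_real, inner_smul_right,
      norm_smul, hξ, real_inner_comm ξ p, mul_one, Real.norm_eq_abs, sq_abs]
    ring
  have hsum {p : V} (hp : p ∈ Metric.ball (0 : V) Real.pi) :
      HasSum (fun n : ℕ => 2 * (‖L p‖ ^ 2 / (((n + 1) * Real.pi) ^ 2 - ‖p‖ ^ 2)))
        ((1 - ‖p‖ * Real.cot ‖p‖) / ‖p‖ ^ 2 * (‖p‖ ^ 2 - ⟪ξ, p⟫ ^ 2)) := by
    rcases eq_or_ne p 0 with rfl | h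
    · simp
    · rw [← hL]
      have := (hasSum_one_sub_mul_cot (norm_pos_iff.mpr h) (mem_ball_zero_iff.mp hp)).mul_right
        (‖L p‖ ^ 2)
      simpa only [mul_div_assoc', div_mul_eq_mul_div] using this
  refine (concaveOn_const (1 : ℝ) (convex_ball _ _)).sub ⟨convex_ball _ _, ?_⟩
  intro p hp q hq a b ha hb hab
  refine hasSum_le (fun n => ?_) (hsum (convex_ball _ _ hp hq ha hb hab))
    (((hsum hp).const_smul a).add ((hsum hq).const_smul b))
  have hsub : Metric.ball (0 : V) Real.pi ⊆ Metric.ball (0 : V) ((n + 1) * Real.pi) :=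
    Metric.ball_subset_ball (by
      nlinarith [Real.pi_pos, mul_nonneg (n.cast_nonneg : (0 : ℝ) ≤ n) Real.pi_pos.le])
  have := ((convexOn_norm_sq_div L ((n + 1) * Real.pi)).smul zero_le_two).2
    (hsub hp) (hsub hq) ha hb hab
  simpa using this

/-! ### The Hessian of the squared distance -/

theorem inner_exp (x : S2) (p : Tan x) :
    ⟪(x : EuclideanSpace ℝ (Fin 3)), (exp x p : EuclideanSpace ℝ (Fin 3))⟫ = Real.cos ‖p‖ := by
  simp [exp, inner_add_right, inner_smul_right, inner_coe_tan]

theorem inner_tan_exp (x : S2) (ξ p : Tan x) :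
    ⟪(ξ : EuclideanSpace ℝ (Fin 3)), (exp x p : EuclideanSpace ℝ (Fin 3))⟫
      = Real.sinc ‖p‖ * ⟪ξ, p⟫ := by
  have h : ⟪(ξ : EuclideanSpace ℝ (Fin 3)), (x : EuclideanSpace ℝ (Fin 3))⟫ = 0 := by
    rw [real_inner_comm, inner_coe_tan]
  simp only [exp, inner_add_right, inner_smul_right, h, mul_zero, zero_add, Submodule.coe_inner]

theorem gdist_exp_self (x : S2) {v : Tan x} (hv : ‖v‖ ≤ Real.pi) : gdist (exp x v) x = ‖v‖ := by
  rw [gdist, real_inner_comm, inner_exp, Real.arccos_cos (norm_nonneg v) hv]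

theorem abs_cos_lt_one {r : ℝ} (h0 : 0 < r) (h1 : r < Real.pi) : |Real.cos r| < 1 := by
  rw [← sq_lt_one_iff_abs_lt_one]
  nlinarith [Real.sin_sq_add_cos_sq r, Real.sin_pos_of_pos_of_lt_pi h0 h1]

theorem contDiffAt_gdist_sq (x : S2) {p : Tan x} (hp : ‖p‖ < Real.pi) :
    ContDiffAt ℝ 2 (fun v : Tan x => gdist (exp x v) (exp x p) ^ 2) 0 := by
  -- `arccos` is not differentiable at `1`, so the case `p = 0` is treated separately.
  rcases eq_or_ne p 0 with rfl | h0
  · have h : (fun v : Tan x => gdist (exp x v) (exp x 0) ^ 2) =ᶠ[nhds 0] fun v => ‖v‖ ^ 2 := by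
      filter_upwards [Metric.ball_mem_nhds (0 : Tan x) Real.pi_pos] with v hv
      rw [exp_zero, gdist_exp_self x (mem_ball_zero_iff.mp hv).le]
    exact (contDiff_norm_sq ℝ).contDiffAt.congr_of_eventuallyEq h
  · have hc := abs_lt.mp (abs_cos_lt_one (norm_pos_iff.mpr h0) hp)
    have h0' : ⟪(exp x 0 : EuclideanSpace ℝ (Fin 3)), (exp x p : EuclideanSpace ℝ (Fin 3))⟫
        = Real.cos ‖p‖ := by rw [exp_zero, inner_exp]
    have hu : ContDiffAt ℝ 2 (fun v : Tan x =>
        ⟪(exp x v : EuclideanSpace ℝ (Fin 3)), (exp x p : EuclideanSpace ℝ (Fin 3))⟫) 0 :=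
      ((contDiff_exp x (n := 2)).inner ℝ contDiff_const).contDiffAt
    have ha := Real.contDiffAt_arccos (x := Real.cos ‖p‖) hc.1.ne' hc.2.ne (n := 2)
    rw [← h0'] at ha
    exact (ha.comp (0 : Tan x) hu).pow 2

/-- The second derivative at `0` of the squared distance to a fixed point along a unit-speed
geodesic: `r` is the distance at time `0`, and the cosine of the distance has
derivative `β` there. -/
theorem hasDerivAt_arccos_sq {r β : ℝ} (h0 : 0 < r) (hπ : r < Real.pi) :
    ∃ g' : ℝ → ℝ,
      (∀ᶠ t in nhds (0 : ℝ), HasDerivAt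
        (fun t => Real.arccos (Real.cos t * Real.cos r + Real.sin t * β) ^ 2) (g' t) t) ∧
      HasDerivAt g' (2 * ((β / Real.sin r) ^ 2
        + r * Real.cot r * (1 - (β / Real.sin r) ^ 2))) 0 := by
  have hσ := Real.sin_pos_of_pos_of_lt_pi h0 hπ
  have hσ2 : 1 - Real.cos r ^ 2 = Real.sin r ^ 2 := by linarith [Real.sin_sq_add_cos_sq r]
  have hc := abs_lt.mp (abs_cos_lt_one h0 hπ)
  set u : ℝ → ℝ := fun t => Real.cos t * Real.cos r + Real.sin t * β with hu
  set u' : ℝ → ℝ := fun t => -Real.sin t * Real.cos r + Real.cos t * β with hu'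
  have hud (t : ℝ) : HasDerivAt u (u' t) t :=
    ((Real.hasDerivAt_cos t).mul_const _).add ((Real.hasDerivAt_sin t).mul_const _)
  have hud' : HasDerivAt u' (-Real.cos r) 0 := by
    have := ((Real.hasDerivAt_sin 0).fun_neg.mul_const (Real.cos r)).fun_add
      ((Real.hasDerivAt_cos 0).mul_const β)
    simpa [hu'] using this
  have hu0 : u 0 = Real.cos r := by simp [hu]
  have hu'0 : u' 0 = β := by simp [hu']
  have hcont : ContinuousAt u 0 := (hud 0).continuousAt
  have harc {t : ℝ} (h1 : u t ≠ -1) (h2 : u t ≠ 1) :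
      HasDerivAt (fun t => Real.arccos (u t)) (-(1 / √(1 - u t ^ 2)) * u' t) t :=
    (Real.hasDerivAt_arccos h1 h2).comp t (hud t)
  refine ⟨fun t => 2 * Real.arccos (u t) * (-(1 / √(1 - u t ^ 2)) * u' t), ?_, ?_⟩
  · have e1 : ∀ᶠ t in nhds (0 : ℝ), u t ≠ -1 := hcont.eventually_ne (by rw [hu0]; exact hc.1.ne')
    have e2 : ∀ᶠ t in nhds (0 : ℝ), u t ≠ 1 := hcont.eventually_ne (by rw [hu0]; exact hc.2.ne)
    filter_upwards [e1, e2] with t h1 h2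
    simpa using (harc h1 h2).fun_pow 2
  · have h1 := harc (t := 0) (by rw [hu0]; exact hc.1.ne') (by rw [hu0]; exact hc.2.ne)
    have hw : HasDerivAt (fun t => 1 - u t ^ 2) (-(2 * u 0 * u' 0)) 0 := by
      simpa using ((hud 0).fun_pow 2).const_sub 1
    have hs := hw.sqrt (by rw [hu0, hσ2]; positivity)
    have hsqrt : √(1 - u 0 ^ 2) = Real.sin r := by rw [hu0, hσ2, Real.sqrt_sq hσ.le]
    have hi := hs.fun_inv (by rw [hsqrt]; exact hσ.ne')
    have hfin := (h1.const_mul 2).fun_mul (hi.fun_neg.fun_mul hud')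
    simp only [one_div]
    refine hfin.congr_deriv ?_
    rw [hsqrt, hu0, hu'0, Real.arccos_cos h0.le hπ.le, Real.cot_eq_cos_div_sin]
    field_simp
    ring

/-- The Hessian of half the squared distance to `exp_x p` has eigenvalue `1` in the direction `p`
and `‖p‖ cot ‖p‖` in the orthogonal direction. -/
theorem half_inner_hess_gdist_sq (x : S2) {p : Tan x} (hp : ‖p‖ < Real.pi) {ξ : Tan x}
    (hξ : ‖ξ‖ = 1) :
    1 / 2 * ⟪hess (fun z => gdist z (exp x p) ^ 2) x ξ, ξ⟫ = distHess ξ p := by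
  rcases eq_or_ne p 0 with rfl | h0
  · have h : ⟪hess (fun z => gdist z (exp x 0) ^ 2) x ξ, ξ⟫ = 2 := by
      refine inner_hess_self (g' := fun t => 2 * t) (contDiffAt_gdist_sq x hp) ?_ ?_
      · filter_upwards [Metric.ball_mem_nhds (0 : ℝ) Real.pi_pos] with t ht
        have heq : (fun t : ℝ => gdist (exp x (t • ξ)) (exp x 0) ^ 2)
            =ᶠ[nhds t] fun t => t ^ 2 := by
          filter_upwards [Metric.isOpen_ball.mem_nhds ht] with t ht
          have ht : |t| < Real.pi := by simpa using ht
          have hn : ‖t • ξ‖ = |t| := by rw [norm_smul, hξ, mul_one, Real.norm_eq_abs]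
          rw [exp_zero, gdist_exp_self x (by rw [hn]; exact ht.le), hn, sq_abs]
        have h2 : HasDerivAt (fun t : ℝ => t ^ 2) (2 * t) t := by simpa using hasDerivAt_pow 2 t
        exact h2.congr_of_eventuallyEq heq
      · simpa using (hasDerivAt_id (0 : ℝ)).const_mul 2
    rw [h]
    simp [distHess]
  · have hr := norm_pos_iff.mpr h0
    have hσ := Real.sin_pos_of_pos_of_lt_pi hr hp
    obtain ⟨g', h1, h2⟩ := hasDerivAt_arccos_sq (β := Real.sinc ‖p‖ * ⟪ξ, p⟫) hr hp
    have hline (t : ℝ) : gdist (exp x (t • ξ)) (exp x p) = Real.arccos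
        (Real.cos t * Real.cos ‖p‖ + Real.sin t * (Real.sinc ‖p‖ * ⟪ξ, p⟫)) := by
      rw [gdist, exp_smul x hξ, inner_add_left, inner_smul_left, inner_smul_left, inner_exp,
        inner_tan_exp]
      rfl
    simp only [← hline] at h1
    rw [inner_hess_self (contDiffAt_gdist_sq x hp) h1 h2, distHess, Real.sinc_of_ne_zero hr.ne']
    field_simp
    ring

theorem half_le_distHess {V : Type*} [NormedAddCommGroup V] [InnerProductSpace ℝ V] {ξ p : V}
    (hξ : ‖ξ‖ = 1) (hp : ‖p‖ ≤ 1) : 1 / 2 ≤ distHess ξ p := by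
  rcases eq_or_ne p 0 with rfl | h0
  · norm_num [distHess]
  · have hr := norm_pos_iff.mpr h0
    have hσ := Real.sin_pos_of_pos_of_lt_pi hr (by linarith [Real.pi_gt_three])
    have hcos : 1 / 2 ≤ Real.cos ‖p‖ := by
      nlinarith [Real.one_sub_sq_div_two_le_cos (x := ‖p‖)]
    have hcot : 1 / 2 ≤ ‖p‖ * Real.cot ‖p‖ := by
      rw [Real.cot_eq_cos_div_sin, mul_div_assoc', le_div_iff₀ hσ]
      nlinarith [Real.sin_le hr.le]
    have hq : ⟪ξ, p⟫ ^ 2 ≤ ‖p‖ ^ 2 := by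
      have := abs_real_inner_le_norm ξ p
      rw [hξ, one_mul] at this
      exact sq_le_sq.mpr (by rwa [abs_norm])
    have hθ : ⟪ξ, p⟫ ^ 2 / ‖p‖ ^ 2 ≤ 1 := (div_le_one (by positivity)).mpr hq
    have hθ0 : 0 ≤ ⟪ξ, p⟫ ^ 2 / ‖p‖ ^ 2 := by positivity
    have : distHess ξ p = (1 - ⟪ξ, p⟫ ^ 2 / ‖p‖ ^ 2) * (‖p‖ * Real.cot ‖p‖)
        + ⟪ξ, p⟫ ^ 2 / ‖p‖ ^ 2 := by
      rw [distHess]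
      field_simp
      ring
    -- a convex combination of `‖p‖ cot ‖p‖ ≥ 1 / 2` and `1`
    rw [this]
    nlinarith

/-! ### Concavity of `log det` in dimension two -/

section LogDet

variable {V : Type*} [NormedAddCommGroup V] [InnerProductSpace ℝ V]

theorem det_eq_orthonormalBasis (b : OrthonormalBasis (Fin 2) ℝ V) (A : V →L[ℝ] V) :
    A.det = ⟪A (b 0), b 0⟫ * ⟪A (b 1), b 1⟫ - ⟪A (b 1), b 0⟫ * ⟪A (b 0), b 1⟫ := by
  have h : A.det = LinearMap.det (A : V →ₗ[ℝ] V) := rfl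
  rw [h, ← LinearMap.det_toMatrix b.toBasis, Matrix.det_fin_two]
  simp [LinearMap.toMatrix_apply, OrthonormalBasis.repr_apply_apply, real_inner_comm]

/-- In dimension two, `log det` is the minimum over orthonormal bases of the sum of the logarithms
of the diagonal entries (Hadamard's inequality, with equality in an eigenbasis), so it inherits
concavity from the quadratic forms. -/
theorem concaveOn_log_det [FiniteDimensional ℝ V] (hV : Module.finrank ℝ V = 2) {I : Set ℝ}
    (hI : Convex ℝ I)
    {A : ℝ → V →L[ℝ] V} (hsymm : ∀ s ∈ I, ∀ v w, ⟪A s v, w⟫ = ⟪v, A s w⟫)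
    (hpos : ∀ s ∈ I, ∀ v, v ≠ 0 → 0 < ⟪A s v, v⟫)
    (hconc : ∀ ξ : V, ‖ξ‖ = 1 → ConcaveOn ℝ I fun s => ⟪A s ξ, ξ⟫) :
    ConcaveOn ℝ I fun s => Real.log (A s).det := by
  refine ⟨hI, fun s hs t ht a b ha hb hab => ?_⟩
  have hm := hI hs ht ha hb hab
  set m := a • s + b • t
  have hS : ((A m : V →ₗ[ℝ] V)).IsSymmetric := hsymm m hm
  -- An eigenbasis at the intermediate time, used as a fixed basis at the two end times.
  let e : OrthonormalBasis (Fin 2) ℝ V := hS.eigenvectorBasis hV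
  have he (i : Fin 2) : ‖e i‖ = 1 := e.norm_eq_one i
  have he0 (i : Fin 2) : e i ≠ 0 := norm_ne_zero_iff.mp (by simp [he])
  have hoff : ⟪A m (e 1), e 0⟫ = 0 := by
    have h : A m (e 1) = hS.eigenvalues hV 1 • e 1 := hS.apply_eigenvectorBasis hV 1
    rw [h, inner_smul_left, e.inner_eq_zero (by decide), mul_zero]
  have hlogconc (i : Fin 2) :
      a * Real.log ⟪A s (e i), e i⟫ + b * Real.log ⟪A t (e i), e i⟫
        ≤ Real.log ⟪A m (e i), e i⟫ := by
    have h1 := (hconc (e i) (he i)).2 hs ht ha hb hab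
    have hps := hpos s hs _ (he0 i)
    have hpt := hpos t ht _ (he0 i)
    have h2 := strictConcaveOn_log_Ioi.concaveOn.2 hps hpt ha hb hab
    refine h2.trans (Real.log_le_log ?_ h1)
    exact (convex_Ioi (0 : ℝ)) hps hpt ha hb hab
  have hadamard (r : ℝ) (hr : r ∈ I) : 0 < (A r).det →
      Real.log (A r).det ≤ Real.log ⟪A r (e 0), e 0⟫ + Real.log ⟪A r (e 1), e 1⟫ := by
    intro hdet
    rw [← Real.log_mul (hpos r hr _ (he0 0)).ne' (hpos r hr _ (he0 1)).ne']
    refine Real.log_le_log hdet ?_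
    have hswap : ⟪A r (e 0), e 1⟫ = ⟪A r (e 1), e 0⟫ := by rw [hsymm r hr, real_inner_comm]
    rw [det_eq_orthonormalBasis e, hswap]
    nlinarith [mul_self_nonneg ⟪A r (e 1), e 0⟫]
  have hdetpos (r : ℝ) (hr : r ∈ I) : 0 < (A r).det := by
    have hSr : ((A r : V →ₗ[ℝ] V)).IsSymmetric := hsymm r hr
    let f : OrthonormalBasis (Fin 2) ℝ V := hSr.eigenvectorBasis hV
    have hf0 (i : Fin 2) : f i ≠ 0 := norm_ne_zero_iff.mp (by simp)
    have hfoff : ⟪A r (f 1), f 0⟫ = 0 := by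
      have h : A r (f 1) = hSr.eigenvalues hV 1 • f 1 := hSr.apply_eigenvectorBasis hV 1
      rw [h, inner_smul_left, f.inner_eq_zero (by decide), mul_zero]
    rw [det_eq_orthonormalBasis f, hfoff, zero_mul, sub_zero]
    exact mul_pos (hpos r hr _ (hf0 0)) (hpos r hr _ (hf0 1))
  have hdm : Real.log (A m).det = Real.log ⟪A m (e 0), e 0⟫ + Real.log ⟪A m (e 1), e 1⟫ := by
    rw [det_eq_orthonormalBasis e, hoff, zero_mul, sub_zero,
      Real.log_mul (hpos m hm _ (he0 0)).ne' (hpos m hm _ (he0 1)).ne']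
  simp only [smul_eq_mul]
  have h1 := mul_le_mul_of_nonneg_left (hadamard s hs (hdetpos s hs)) ha
  have h2 := mul_le_mul_of_nonneg_left (hadamard t ht (hdetpos t ht)) hb
  have h3 := hlogconc 0
  have h4 := hlogconc 1
  rw [hdm]
  linarith

end LogDet

/-! ### Bounds on gradients and Hessians -/

/-- Near any point, a `C²` function on the sphere extends to a `C²` function on a neighbourhood in
`ℝ³`: compose it with stereographic projection from the antipodal point. -/
theorem exists_contDiffAt_extension {φ : S2 → ℝ} (hφ : ContMDiff (𝓡 2) 𝓘(ℝ, ℝ) 2 φ) (x₀ : S2) :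
    ∃ Φ : EuclideanSpace ℝ (Fin 3) → ℝ, ContDiffAt ℝ 2 Φ x₀ ∧ ∀ z : S2, z ≠ -x₀ → φ z = Φ z := by
  have : Fact (Module.finrank ℝ (EuclideanSpace ℝ (Fin 3)) = 2 + 1) := ⟨by simp⟩
  let c := chartAt (EuclideanSpace ℝ (Fin 2)) x₀
  let U := (OrthonormalBasis.fromOrthogonalSpanSingleton (𝕜 := ℝ) 2
    (ne_zero_of_mem_unit_sphere (-x₀))).repr
  have hc : c = stereographic' 2 (-x₀) := rfl
  have hψ : ContDiff ℝ 2 (φ ∘ c.symm) := by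
    have h : ContMDiffOn (𝓡 2) (𝓡 2) 2 c.symm c.target := contMDiffOn_chart_symm
    have ht : c.target = Set.univ := by rw [hc, stereographic'_target]
    rw [ht, contMDiffOn_univ] at h
    exact (hφ.comp h).contDiff
  refine ⟨fun z => (φ ∘ c.symm) (U (stereoToFun (-x₀ : EuclideanSpace ℝ (Fin 3)) z)), ?_, ?_⟩
  · have hopen : {z : EuclideanSpace ℝ (Fin 3) |
        innerSL ℝ (-x₀ : EuclideanSpace ℝ (Fin 3)) z ≠ (1 : ℝ)} ∈
        nhds (x₀ : EuclideanSpace ℝ (Fin 3)) := by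
      refine IsOpen.mem_nhds (isOpen_ne_fun (by fun_prop) (by fun_prop)) ?_
      simp
      norm_num
    exact hψ.contDiffAt.comp _ (U.contDiff.contDiffAt.comp _
      (contDiffOn_stereoToFun.contDiffAt hopen))
  · intro z hz
    have hz' : z ∈ c.source := by rw [hc, stereographic'_source]; exact hz
    exact congrArg φ (c.left_inv hz').symm

theorem eventually_exp_ne {x y : S2} (h : x ≠ y) : ∀ᶠ v in nhds (0 : Tan x), exp x v ≠ y := by
  have hc : Continuous (exp x) := continuous_induced_rng.mpr (contDiff_exp x (n := 0)).continuous
  exact hc.continuousAt.eventually_ne (by rwa [exp_zero])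

theorem contDiffAt_comp_exp {φ : S2 → ℝ} {Φ : EuclideanSpace ℝ (Fin 3) → ℝ} {x y : S2}
    (hΦ : ContDiffAt ℝ 2 Φ x) (hxy : x ≠ y) (h : ∀ z : S2, z ≠ y → φ z = Φ z) :
    ContDiffAt ℝ 2 (fun v : Tan x => φ (exp x v)) 0 := by
  have h1 : (fun v : Tan x => φ (exp x v)) =ᶠ[nhds 0] fun v => Φ (exp x v) :=
    (eventually_exp_ne hxy).mono fun v hv => h _ hv
  refine ContDiffAt.congr_of_eventuallyEq ?_ h1
  rw [← exp_zero x] at hΦ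
  exact hΦ.comp (0 : Tan x) (contDiff_exp x (n := 2)).contDiffAt

theorem contDiffAt_exp_of_contMDiff {φ : S2 → ℝ} (hφ : ContMDiff (𝓡 2) 𝓘(ℝ, ℝ) 2 φ) (x : S2) :
    ContDiffAt ℝ 2 (fun v : Tan x => φ (exp x v)) 0 := by
  obtain ⟨Φ, hΦ, h⟩ := exists_contDiffAt_extension hφ x
  exact contDiffAt_comp_exp hΦ (ne_neg_of_mem_unit_sphere ℝ x) h

theorem hasDerivAt_exp_smul (x : S2) {ξ : Tan x} (hξ : ‖ξ‖ = 1) (t : ℝ) :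
    HasDerivAt (fun t : ℝ => (exp x (t • ξ) : EuclideanSpace ℝ (Fin 3)))
      (-Real.sin t • (x : EuclideanSpace ℝ (Fin 3)) +
        Real.cos t • (ξ : EuclideanSpace ℝ (Fin 3))) t := by
  simp only [exp_smul x hξ]
  exact ((Real.hasDerivAt_cos t).smul_const _).fun_add ((Real.hasDerivAt_sin t).smul_const _)

theorem eventually_hasDerivAt_geodesic {φ : S2 → ℝ} {Φ : EuclideanSpace ℝ (Fin 3) → ℝ} {x y : S2}
    (hΦ : ContDiffAt ℝ 2 Φ x) (hxy : x ≠ y) (h : ∀ z : S2, z ≠ y → φ z = Φ z)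
    {ξ : Tan x} (hξ : ‖ξ‖ = 1) :
    ∀ᶠ t in nhds (0 : ℝ), HasDerivAt (fun t : ℝ => φ (exp x (t • ξ)))
      (fderiv ℝ Φ (exp x (t • ξ)) (-Real.sin t • (x : EuclideanSpace ℝ (Fin 3)) +
        Real.cos t • (ξ : EuclideanSpace ℝ (Fin 3)))) t := by
  have hlim : Filter.Tendsto (fun t : ℝ => t • ξ) (nhds 0) (nhds 0) := by
    have : Continuous fun t : ℝ => t • ξ := by fun_prop
    simpa using this.tendsto 0
  have hlimE : Filter.Tendsto (fun t : ℝ => (exp x (t • ξ) : EuclideanSpace ℝ (Fin 3))) (nhds 0)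
      (nhds x) := by
    simpa [exp_zero] using (hasDerivAt_exp_smul x hξ 0).continuousAt.tendsto
  filter_upwards [hlimE.eventually (hΦ.eventually (by simp)),
    (hlim.eventually (eventually_exp_ne hxy)).eventually_nhds] with t ht hne
  have hd := (ht.differentiableAt two_ne_zero).hasFDerivAt.comp_hasDerivAt t
    (hasDerivAt_exp_smul x hξ t)
  exact hd.congr_of_eventuallyEq (hne.mono fun s hs => h _ hs)

theorem inner_grad_eq {φ : S2 → ℝ} {Φ : EuclideanSpace ℝ (Fin 3) → ℝ} {x y : S2}
    (hΦ : ContDiffAt ℝ 2 Φ x) (hxy : x ≠ y) (h : ∀ z : S2, z ≠ y → φ z = Φ z)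
    {ξ : Tan x} (hξ : ‖ξ‖ = 1) : ⟪grad φ x, ξ⟫ = fderiv ℝ Φ x ξ := by
  have hψ : HasFDerivAt (fun v : Tan x => φ (exp x v))
      (fderiv ℝ (fun v : Tan x => φ (exp x v)) 0) ((0 : ℝ) • ξ) := by
    rw [zero_smul]
    exact ((contDiffAt_comp_exp hΦ hxy h).differentiableAt two_ne_zero).hasFDerivAt
  have hline : HasDerivAt (fun t : ℝ => t • ξ) ξ 0 := by
    simpa using (hasDerivAt_id (0 : ℝ)).smul_const ξ
  have h1 := hψ.comp_hasDerivAt (0 : ℝ) hline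
  have h2 := (eventually_hasDerivAt_geodesic hΦ hxy h hξ).self_of_nhds
  have h3 : ⟪grad φ x, ξ⟫ = fderiv ℝ (fun v : Tan x => φ (exp x v)) 0 ξ :=
    InnerProductSpace.toDual_symm_apply
  rw [h3]
  have h4 := h1.unique h2
  simpa [exp_zero] using h4

/-- The last term appears because the great circle has acceleration `-x` at `x`. -/
theorem inner_hess_eq {φ : S2 → ℝ} {Φ : EuclideanSpace ℝ (Fin 3) → ℝ} {x y : S2}
    (hΦ : ContDiffAt ℝ 2 Φ x) (hxy : x ≠ y) (h : ∀ z : S2, z ≠ y → φ z = Φ z)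
    {ξ : Tan x} (hξ : ‖ξ‖ = 1) :
    ⟪hess φ x ξ, ξ⟫ = fderiv ℝ (fderiv ℝ Φ) x ξ ξ - fderiv ℝ Φ x x := by
  refine inner_hess_self (contDiffAt_comp_exp hΦ hxy h)
    (eventually_hasDerivAt_geodesic hΦ hxy h hξ) ?_
  have h0 : (exp x ((0 : ℝ) • ξ) : EuclideanSpace ℝ (Fin 3)) = x := by rw [zero_smul, exp_zero]
  have hdd : HasFDerivAt (fderiv ℝ Φ) (fderiv ℝ (fderiv ℝ Φ) x)
      (exp x ((0 : ℝ) • ξ) : EuclideanSpace ℝ (Fin 3)) := by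
    rw [h0]
    exact ((hΦ.fderiv_right (m := 1) (by norm_num)).differentiableAt one_ne_zero).hasFDerivAt
  have h1 := hdd.comp_hasDerivAt (0 : ℝ) (hasDerivAt_exp_smul x hξ 0)
  have h2 : HasDerivAt (fun t : ℝ => -Real.sin t • (x : EuclideanSpace ℝ (Fin 3)) +
      Real.cos t • (ξ : EuclideanSpace ℝ (Fin 3))) (-(x : EuclideanSpace ℝ (Fin 3))) 0 := by
    simpa using ((Real.hasDerivAt_sin 0).fun_neg.smul_const
      (x : EuclideanSpace ℝ (Fin 3))).fun_add
      ((Real.hasDerivAt_cos 0).smul_const (ξ : EuclideanSpace ℝ (Fin 3)))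
  have h3 := h1.clm_apply h2
  refine h3.congr_deriv ?_
  simp [exp_zero, sub_eq_add_neg]

theorem eventually_norm_lt_add_one {X F : Type*} [TopologicalSpace X] [NormedAddCommGroup F]
    {f : X → F} {x₀ : X} (hf : ContinuousAt f x₀) : ∀ᶠ x in nhds x₀, ‖f x‖ < ‖f x₀‖ + 1 :=
  hf.norm.eventually_lt_const (lt_add_one _)

theorem exists_eventually_abs_fderiv_le {V : Type*} [NormedAddCommGroup V] [NormedSpace ℝ V]
    {Φ : V → ℝ} {x₀ : V} (hΦ : ContDiffAt ℝ 2 Φ x₀) :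
    ∃ K₁ K₂ : ℝ, 0 ≤ K₁ ∧ 0 ≤ K₂ ∧ ∀ᶠ x in nhds x₀, ContDiffAt ℝ 2 Φ x ∧
      (∀ v, |fderiv ℝ Φ x v| ≤ K₁ * ‖v‖) ∧
      ∀ v w, |fderiv ℝ (fderiv ℝ Φ) x v w| ≤ K₂ * ‖v‖ * ‖w‖ := by
  have hD : ContDiffAt ℝ 1 (fderiv ℝ Φ) x₀ := hΦ.fderiv_right (by norm_num)
  have hDD : ContDiffAt ℝ 0 (fderiv ℝ (fderiv ℝ Φ)) x₀ := hD.fderiv_right (by norm_num)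
  refine ⟨‖fderiv ℝ Φ x₀‖ + 1, ‖fderiv ℝ (fderiv ℝ Φ) x₀‖ + 1, by positivity, by positivity, ?_⟩
  filter_upwards [hΦ.eventually (by simp),
    eventually_norm_lt_add_one hD.continuousAt,
    eventually_norm_lt_add_one hDD.continuousAt]
    with x hx h1 h2
  refine ⟨hx, fun v => ((fderiv ℝ Φ x).le_opNorm v).trans ?_,
    fun v w => ((fderiv ℝ (fderiv ℝ Φ) x).le_opNorm₂ v w).trans ?_⟩
  · gcongr
  · gcongr

theorem exists_bound_grad_hess {φ : S2 → ℝ} (hφ : ContMDiff (𝓡 2) 𝓘(ℝ, ℝ) 2 φ) :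
    ∃ K : ℝ, ∀ x : S2, ‖grad φ x‖ ≤ K ∧ ∀ ξ : Tan x, ‖ξ‖ = 1 → |⟪hess φ x ξ, ξ⟫| ≤ K := by
  suffices ∃ K : ℝ, ∀ x ∈ (Set.univ : Set S2),
      ‖grad φ x‖ ≤ K ∧ ∀ ξ : Tan x, ‖ξ‖ = 1 → |⟪hess φ x ξ, ξ⟫| ≤ K by simpa using this
  refine (isCompact_univ (X := S2)).induction_on ⟨0, by simp⟩ ?_ ?_ ?_
  · rintro s t hst ⟨K, hK⟩
    exact ⟨K, fun x hx => hK x (hst hx)⟩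
  · rintro s t ⟨K, hK⟩ ⟨K', hK'⟩
    refine ⟨max K K', fun x hx => ?_⟩
    rcases hx with hx | hx
    · exact ⟨(hK x hx).1.trans (le_max_left _ _),
        fun ξ hξ => ((hK x hx).2 ξ hξ).trans (le_max_left _ _)⟩
    · exact ⟨(hK' x hx).1.trans (le_max_right _ _),
        fun ξ hξ => ((hK' x hx).2 ξ hξ).trans (le_max_right _ _)⟩
  · intro x₀ _
    obtain ⟨Φ, hΦ, h⟩ := exists_contDiffAt_extension hφ x₀
    obtain ⟨K₁, K₂, hK₁, hK₂, hb⟩ := exists_eventually_abs_fderiv_le hΦ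
    have hcoe : Filter.Tendsto (fun x : S2 => (x : EuclideanSpace ℝ (Fin 3))) (nhds x₀)
        (nhds (x₀ : EuclideanSpace ℝ (Fin 3))) := continuous_subtype_val.tendsto x₀
    have hne : ∀ᶠ x in nhds x₀, x ≠ -x₀ :=
      continuousAt_id.eventually_ne (ne_neg_of_mem_unit_sphere ℝ x₀)
    refine ⟨_, mem_nhdsWithin_of_mem_nhds (Filter.inter_mem hne (hcoe.eventually hb)),
      K₁ + K₂, ?_⟩
    rintro x ⟨hx, hΦx, hx1, hx2⟩
    have hnx : ‖(x : EuclideanSpace ℝ (Fin 3))‖ = 1 := by simp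
    constructor
    · rcases eq_or_ne (grad φ x) 0 with h0 | h0
      · rw [h0, norm_zero]
        positivity
      · have hn := norm_pos_iff.mpr h0
        have hξ : ‖‖grad φ x‖⁻¹ • grad φ x‖ = 1 := norm_smul_inv_norm h0
        have h1 := inner_grad_eq hΦx hx h hξ
        rw [inner_smul_right, real_inner_self_eq_norm_sq, sq, inv_mul_cancel_left₀ hn.ne'] at h1
        rw [h1]
        have := hx1 (‖grad φ x‖⁻¹ • grad φ x : Tan x)
        rw [← Submodule.coe_norm, hξ, mul_one] at this
        linarith [le_abs_self (fderiv ℝ Φ (x : EuclideanSpace ℝ (Fin 3))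
          ((‖grad φ x‖⁻¹ • grad φ x : Tan x) : EuclideanSpace ℝ (Fin 3)))]
    · intro ξ hξ
      rw [inner_hess_eq hΦx hx h hξ]
      have h1 := hx1 x
      have h2 := hx2 ξ ξ
      have hξ' : ‖(ξ : EuclideanSpace ℝ (Fin 3))‖ = 1 := hξ
      rw [hnx, mul_one] at h1
      rw [hξ', mul_one, mul_one] at h2
      refine (abs_sub _ _).trans ?_
      linarith

/-! ### The interpolated Hessian -/

/-- The tangent vector at `x` whose exponential is `interp φ₀ φₕ h x s h`. -/
noncomputable def interpVec (φ₀ φₕ : S2 → ℝ) (h : ℝ) (x : S2) (s : ℝ) : Tan x :=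
  ((1 - s) * h) • grad φ₀ x + (h * s * h) • grad φₕ x

theorem norm_interpVec_le (φ₀ φₕ : S2 → ℝ) {h γ : ℝ} (hh : 0 < h) (hγ : 1 ≤ γ) (x : S2) {s : ℝ}
    (hs : s ∈ Set.Icc (0 : ℝ) 1) :
    ‖interpVec φ₀ φₕ h x s‖ ≤ h * ‖grad φ₀ x‖ + γ * h ^ 2 * ‖grad φₕ x‖ := by
  obtain ⟨hs0, hs1⟩ := hs
  have h1s : 0 ≤ 1 - s := by linarith
  refine (norm_add_le _ _).trans (add_le_add ?_ ?_)
  · rw [norm_smul, Real.norm_of_nonneg (by positivity)]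
    exact mul_le_mul_of_nonneg_right (mul_le_of_le_one_left hh.le (by linarith)) (norm_nonneg _)
  · rw [norm_smul, Real.norm_of_nonneg (by positivity)]
    refine mul_le_mul_of_nonneg_right ?_ (norm_nonneg _)
    nlinarith [mul_le_mul (hs1.trans hγ) le_rfl (sq_nonneg h) (by linarith)]

theorem inner_interpHess (φ₀ φₕ : S2 → ℝ) {h : ℝ} {x : S2} {t s : ℝ}
    (hp : ‖interpVec φ₀ φₕ h x s‖ < Real.pi) {ξ : Tan x} (hξ : ‖ξ‖ = 1) :
    ⟪interpHess φ₀ φₕ h x t s ξ, ξ⟫ = distHess ξ (interpVec φ₀ φₕ h x s) +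
      ((1 - s) * t * ⟪hess φ₀ x ξ, ξ⟫ + h * s * t * ⟪hess φₕ x ξ, ξ⟫) := by
  rw [← half_inner_hess_gdist_sq x hp hξ]
  simp only [interpHess, add_apply, smul_apply,
    inner_add_left, real_inner_smul_left, add_assoc]
  rfl

theorem concaveOn_inner_interpHess (φ₀ φₕ : S2 → ℝ) {h : ℝ} {x : S2} (t : ℝ)
    (hp : ∀ s ∈ Set.Icc (0 : ℝ) 1, ‖interpVec φ₀ φₕ h x s‖ < Real.pi) {ξ : Tan x} (hξ : ‖ξ‖ = 1) :
    ConcaveOn ℝ (Set.Icc (0 : ℝ) 1) fun s => ⟪interpHess φ₀ φₕ h x t s ξ, ξ⟫ := by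
  refine ⟨convex_Icc _ _, fun s hs r hr a b ha hb hab => ?_⟩
  have hm := convex_Icc (0 : ℝ) 1 hs hr ha hb hab
  have haff : interpVec φ₀ φₕ h x (a • s + b • r)
      = a • interpVec φ₀ φₕ h x s + b • interpVec φ₀ φₕ h x r := by
    obtain rfl : b = 1 - a := by linarith
    simp only [interpVec, smul_eq_mul]
    module
  have hc := (concaveOn_distHess hξ).2 (mem_ball_zero_iff.mpr (hp s hs))
    (mem_ball_zero_iff.mpr (hp r hr)) ha hb hab
  rw [← haff] at hc
  simp only [inner_interpHess φ₀ φₕ (hp _ hs) hξ, inner_interpHess φ₀ φₕ (hp _ hr) hξ,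
    inner_interpHess φ₀ φₕ (hp _ hm) hξ]
  simp only [smul_eq_mul] at hc ⊢
  refine le_trans (le_of_eq ?_) (add_le_add_left hc _)
  obtain rfl : b = 1 - a := by linarith
  ring

theorem finrank_tan (x : S2) : Module.finrank ℝ (Tan x) = 2 := by
  have : Fact (Module.finrank ℝ (EuclideanSpace ℝ (Fin 3)) = 2 + 1) := ⟨by simp⟩
  exact Submodule.finrank_orthogonal_span_singleton (ne_zero_of_mem_unit_sphere x)

theorem isPosDef_of_unit {x : S2} {A : Tan x →L[ℝ] Tan x}
    (hsymm : ∀ v w : Tan x, ⟪A v, w⟫ = ⟪v, A w⟫) (h : ∀ ξ : Tan x, ‖ξ‖ = 1 → 0 < ⟪A ξ, ξ⟫) :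
    IsPosDef A := by
  refine ⟨hsymm, fun v hv => ?_⟩
  have h1 := h (‖v‖⁻¹ • v) (norm_smul_inv_norm hv)
  rw [map_smul, real_inner_smul_left, real_inner_smul_right, ← mul_assoc] at h1
  exact pos_of_mul_pos_right h1 (by positivity)

theorem inner_interpHess_comm {φ₀ φₕ : S2 → ℝ} (hφ₀ : ContMDiff (𝓡 2) 𝓘(ℝ, ℝ) 2 φ₀)
    (hφₕ : ContMDiff (𝓡 2) 𝓘(ℝ, ℝ) 2 φₕ) {h : ℝ} {x : S2} {t s : ℝ}
    (hp : ‖interpVec φ₀ φₕ h x s‖ < Real.pi) (v w : Tan x) :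
    ⟪interpHess φ₀ φₕ h x t s v, w⟫ = ⟪v, interpHess φ₀ φₕ h x t s w⟫ := by
  have hd : ⟪hess (fun z => gdist z (interp φ₀ φₕ h x s h) ^ 2) x v, w⟫ =
      ⟪v, hess (fun z => gdist z (interp φ₀ φₕ h x s h) ^ 2) x w⟫ :=
    inner_hess_comm (contDiffAt_gdist_sq x hp) v w
  simp only [interpHess, add_apply, smul_apply,
    inner_add_left, inner_add_right, real_inner_smul_left, real_inner_smul_right, hd,
    inner_hess_comm (contDiffAt_exp_of_contMDiff hφ₀ x) v w,
    inner_hess_comm (contDiffAt_exp_of_contMDiff hφₕ x) v w]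

end S2

theorem proposition10 (φ₀ φₕ : S2 → ℝ)
    (hφ₀ : ContMDiff (𝓡 2) 𝓘(ℝ, ℝ) 2 φ₀) (hφₕ : ContMDiff (𝓡 2) 𝓘(ℝ, ℝ) 2 φₕ)
    (γ : ℝ) (hγ : 1 ≤ γ) :
    -- concavity whenever the gradients are small and the endomorphism is positive definite
    (∀ h : ℝ, 0 < h →
      (∀ x : S2, h * ‖S2.grad φ₀ x‖ + γ * h ^ 2 * ‖S2.grad φₕ x‖ < Real.pi / 2) →
      ∀ (x : S2), ∀ t ∈ Set.Icc (0 : ℝ) h,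
        (∀ s ∈ Set.Icc (0 : ℝ) 1, S2.IsPosDef (S2.interpHess φ₀ φₕ h x t s)) →
        ConcaveOn ℝ (Set.Icc (0 : ℝ) 1)
          (fun s => Real.log (S2.interpHess φ₀ φₕ h x t s).det)) ∧
    -- both conditions hold for all sufficiently small time steps
    (∃ h₀ : ℝ, 0 < h₀ ∧ ∀ h : ℝ, 0 < h → h < h₀ →
      (∀ x : S2, h * ‖S2.grad φ₀ x‖ + γ * h ^ 2 * ‖S2.grad φₕ x‖ < Real.pi / 2) ∧
      ∀ (x : S2), ∀ t ∈ Set.Icc (0 : ℝ) h, ∀ s ∈ Set.Icc (0 : ℝ) 1,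
        S2.IsPosDef (S2.interpHess φ₀ φₕ h x t s)) := by
  have hpi := Real.pi_gt_three
  constructor
  · intro h hh hgrad x t _ hpos
    refine S2.concaveOn_log_det (S2.finrank_tan x) (convex_Icc _ _) (fun s hs => (hpos s hs).1)
      (fun s hs => (hpos s hs).2) fun ξ hξ => ?_
    refine S2.concaveOn_inner_interpHess φ₀ φₕ t (fun s hs => ?_) hξ
    linarith [S2.norm_interpVec_le φ₀ φₕ hh hγ x hs, hgrad x]
  · obtain ⟨K₀, hK₀⟩ := S2.exists_bound_grad_hess hφ₀
    obtain ⟨K₁, hK₁⟩ := S2.exists_bound_grad_hess hφₕ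
    have hx₀ : ∃ x : S2, True := ⟨⟨EuclideanSpace.single 0 1, by simp⟩, trivial⟩
    obtain ⟨x₀, -⟩ := hx₀
    have hK₀0 : 0 ≤ K₀ := (norm_nonneg _).trans (hK₀ x₀).1
    have hK₁0 : 0 ≤ K₁ := (norm_nonneg _).trans (hK₁ x₀).1
    -- For `h < h₀` one has `h ≤ 1` and `h * K₀ + h * (γ * K₁) < 1 / 2`, which dominates both
    -- `‖p‖` and, as `1 ≤ γ`, the Hessian terms.
    have hc : 0 < 2 * (K₀ + γ * K₁ + 1) := by positivity
    refine ⟨1 / (2 * (K₀ + γ * K₁ + 1)), by positivity, fun h hh hlt => ?_⟩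
    rw [lt_div_iff₀ hc] at hlt
    have hγK : K₁ ≤ γ * K₁ := le_mul_of_one_le_left hK₁0 hγ
    have hh1 : h ≤ 1 := by nlinarith
    have hsum : h * K₀ + h * (γ * K₁) < 1 / 2 := by nlinarith
    have hsmall (x : S2) : h * ‖S2.grad φ₀ x‖ + γ * h ^ 2 * ‖S2.grad φₕ x‖ ≤ 1 := by
      have h1 : h * ‖S2.grad φ₀ x‖ ≤ h * K₀ := mul_le_mul_of_nonneg_left (hK₀ x).1 hh.le
      have h2 : γ * h ^ 2 * ‖S2.grad φₕ x‖ ≤ γ * h ^ 2 * K₁ :=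
        mul_le_mul_of_nonneg_left (hK₁ x).1 (by positivity)
      have h3 : γ * h ^ 2 * K₁ ≤ h * (γ * K₁) := by
        have : 0 ≤ h * (γ * K₁) := by positivity
        nlinarith
      linarith
    refine ⟨fun x => by linarith [hsmall x], fun x t ht s hs => ?_⟩
    have hp1 := (S2.norm_interpVec_le φ₀ φₕ hh hγ x hs).trans (hsmall x)
    have hp : ‖S2.interpVec φ₀ φₕ h x s‖ < Real.pi := by linarith
    refine S2.isPosDef_of_unit (S2.inner_interpHess_comm hφ₀ hφₕ hp) fun ξ hξ => ?_
    rw [S2.inner_interpHess φ₀ φₕ hp hξ]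
    have h0 := S2.half_le_distHess hξ hp1
    obtain ⟨ht0, hth⟩ := ht
    obtain ⟨hs0, hs1⟩ := hs
    have hbound {c a K : ℝ} (hc0 : 0 ≤ c) (hch : c ≤ h) (ha : |a| ≤ K) : -(h * K) ≤ c * a := by
      have h1 := (abs_le.mp ha).1
      have hK : 0 ≤ K := (abs_nonneg a).trans ha
      nlinarith [mul_le_mul_of_nonneg_left h1 hc0, mul_le_mul_of_nonneg_right hch hK]
    have h1 := hbound (c := (1 - s) * t) (mul_nonneg (by linarith) ht0)
      (by nlinarith) ((hK₀ x).2 ξ hξ)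
    have h2 := hbound (c := h * s * t) (by positivity)
      (by nlinarith [mul_le_one₀ hs1 ht0 (hth.trans hh1)]) ((hK₁ x).2 ξ hξ)
    nlinarith [mul_le_mul_of_nonneg_left hγK hh.le]
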